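/- For positive integers $m,n$ and a non-negative integer $r$ with $\gcd(m,n)=\gcd(m,r-1)=1$ and $r^n\equiv 1\pmod m$, let $$ZM(m,n,r)=\langle a,b \mid a^m=b^n=1,\ b^{-1}ab=a^r\rangle .$$ For divisors $m_1\mid m$, $n_1\mid n$ let $[H(m_1,n_1,0)]$ be the conjugacy class of the subgroup $H(m_1,n_1,0)=\langle a^{m_1},b^{n_1}\rangle$. For a finite group $G$, let the factorization number $F_2(G)$ be the number of ordered pairs $(H,K)$ of subgroups of $G$ with $G=HK$. Write $(x,y)$ for the greatest common divisor of $x$ and $y$. **Theorem 3.1.** For all such $m,n,r$ and all $m_1\mid m$, $n_1\mid n$, $$\bigl|[H(m_1,n_1,0)]\bigr|=\Bigl(m_1,\tfrac{r^n-1}{r^{n_1}-1}\Bigr),$$ and $$F_2(ZM(m,n,r))=\sum_{\substack{m_2,m_3\mid m\\ n_2,n_3\mid n\\ (m_2,m_3)=1\\ (n_2,n_3)=1}}\Bigl(m_2,\tfrac{r^n-1}{r^{n_2}-1}\Bigr)\Bigl(m_3,\tfrac{r^n-1}{r^{n_3}-1}\Bigr),$$ that is, $F_2(ZM(m,n,r))$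 is the sum of the products $|[H(m_2,n_2,0)]|\cdot|[H(m_3,n_3,0)]|$ over the same index set. Here all divisors are positive; if $r=1$ (which forces $m=1$), each of the greatest common divisors above is read as $1$. In particular, $F_2(ZM(9,4,8))=85$. -/

import Mathlib

open scoped Pointwise

/-- The factorization number `F₂(G)`: the number of pairs `(H, K)` of subgroups of `G` with
`G = HK`, where `HK` is the product set. -/
noncomputable def factorizationNumber (G : Type*) [Group G] : ℕ :=
  Nat.card {p : Subgroup G × Subgroup G // (p.1 : Set G) * (p.2 : Set G) = Set.univ}

/-- The conjugacy class of the subgroup `H` of `G`. -/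
def subgroupConjClass {G : Type*} [Group G] (H : Subgroup G) : Set (Subgroup G) :=
  {K | ∃ g : G, K = H.map (MulAut.conj g).toMonoidHom}

/-- The relators `a ^ m`, `b ^ n`, `b⁻¹ a b (a ^ r)⁻¹` on the free generators `a` (index `0`) and
`b` (index `1`). -/
def zmRels (m n r : ℕ) : Set (FreeGroup (Fin 2)) :=
  {FreeGroup.of 0 ^ m,
   FreeGroup.of 1 ^ n,
   (FreeGroup.of 1)⁻¹ * FreeGroup.of 0 * FreeGroup.of 1 * (FreeGroup.of 0 ^ r)⁻¹}

/-- The group `ZM(m, n, r) = ⟨a, b ∣ a ^ m = b ^ n = 1, b⁻¹ a b = a ^ r⟩`. -/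
abbrev ZM (m n r : ℕ) : Type := PresentedGroup (zmRels m n r)

namespace ZM

/-- The generator `a` of `ZM(m, n, r)`. -/
def a (m n r : ℕ) : ZM m n r := PresentedGroup.of 0

/-- The generator `b` of `ZM(m, n, r)`. -/
def b (m n r : ℕ) : ZM m n r := PresentedGroup.of 1

/-- The subgroup `H(m₁, n₁, 0) = ⟨a ^ m₁, b ^ n₁⟩` of `ZM(m, n, r)`. -/
def H (m n r m₁ n₁ : ℕ) : Subgroup (ZM m n r) :=
  Subgroup.closure {a m n r ^ m₁, b m n r ^ n₁}

/-- The conditions on the parameters: `m, n ≥ 1`, `(m, n) = (m, r - 1) = 1` and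
`r ^ n ≡ 1 (mod m)`. -/
structure Admissible (m n r : ℕ) : Prop where
  m_pos : 0 < m
  n_pos : 0 < n
  coprime_m_n : Nat.gcd m n = 1
  coprime_m_r : Int.gcd (m : ℤ) ((r : ℤ) - 1) = 1
  pow_modEq : r ^ n ≡ 1 [MOD m]

end ZM

/-- The greatest common divisor `(m₁, (r ^ n - 1) / (r ^ n₁ - 1))`, computed in the integers.
For `n₁ ∣ n` the division is exact whenever `r ≠ 1`; if `r = 1`, then admissibility forces
`m = 1`, so that `m₁ = 1` and the greatest common divisor is `1` whatever the quotient. -/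
def zmGcd (n r m₁ n₁ : ℕ) : ℕ :=
  Int.gcd (m₁ : ℤ) (((r : ℤ) ^ n - 1) / ((r : ℤ) ^ n₁ - 1))

/-! Let `π` be the projection onto ℤ/n that kills `a`. A subgroup K has two invariants: the index m₁
of K ∩ ⟨a⟩ in ⟨a⟩, a divisor of m, and the index s of π(K), a divisor of n; their product is the
index of K. Since m and n are coprime, KL = G exactly when the first invariants of K and L are
coprime and so are the second (`coe_mul_coe_eq_univ_iff`). The subgroups with invariants (m₁, s)
form one class, that of ⟨a^m₁, b^s⟩ (`mem_subgroupConjClass_iff`), so F₂ is a sum of products of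
class sizes.

The class size is the index of the normalizer, which contains b, and contains a^t iff m₁ ∣ t(r^s -
1). With Q = (r^n - 1)/(r^s - 1), the numbers (m₁, r^s - 1) and (m₁, Q) are coprime with product m₁,
so the condition reads (m₁, Q) ∣ t. -/

namespace Subgroup

variable {G : Type*} [Group G]

/-- A power of `x` lies in `S` exactly when the exponent is divisible by the index of
`S ⊓ ⟨x⟩` in `⟨x⟩`. -/
theorem zpow_mem_iff_relIndex_zpowers_dvd (S : Subgroup G) (x : G) (t : ℤ) :
    x ^ t ∈ S ↔ (S.relIndex (zpowers x) : ℤ) ∣ t := by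
  obtain ⟨d, hd⟩ := Int.subgroup_cyclic (Subgroup.toAddSubgroup' (S.comap (zpowersHom G x)))
  have hd' : Subgroup.toAddSubgroup' (S.comap (zpowersHom G x)) = AddSubgroup.zmultiples d := by
    rw [hd, AddSubgroup.zmultiples_eq_closure]
  have hrange : (zpowersHom G x).range = zpowers x := by
    ext y
    simp only [MonoidHom.mem_range, mem_zpowers_iff, zpowersHom_apply]
    exact ⟨fun ⟨k, hk⟩ => ⟨k.toAdd, hk⟩, fun ⟨k, hk⟩ => ⟨Multiplicative.ofAdd k, hk⟩⟩
  have hidx : S.relIndex (zpowers x) = d.natAbs := by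
    rw [← hrange, ← index_comap, ← Int.index_zmultiples, ← hd']
    rfl
  have hmem : x ^ t ∈ S ↔ t ∈ AddSubgroup.zmultiples d := by
    rw [← hd']
    rfl
  rw [hmem, Int.mem_zmultiples_iff, hidx, Int.natCast_natAbs, abs_dvd]

theorem relIndex_zpowers_eq_of_forall_zpow_mem_iff {S : Subgroup G} {x : G} {d : ℕ}
    (h : ∀ t : ℤ, x ^ t ∈ S ↔ (d : ℤ) ∣ t) : S.relIndex (zpowers x) = d := by
  apply Nat.dvd_antisymm
  · have := (zpow_mem_iff_relIndex_zpowers_dvd S x d).1 ((h d).2 dvd_rfl)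
    exact_mod_cast this
  · have := (h _).1 ((zpow_mem_iff_relIndex_zpowers_dvd S x (S.relIndex (zpowers x))).2 dvd_rfl)
    exact_mod_cast this

/-- Compute the index of `K ⊓ f.ker` through `K` and through `f.ker`, then cancel the index of `K ⊓
f.ker` in `K`. -/
theorem index_eq_relIndex_ker_mul_index_map [Finite G] {G' : Type*} [Group G'] {f : G →* G'}
    (hf : Function.Surjective f) (K : Subgroup G) :
    K.index = K.relIndex f.ker * (K.map f).index := by
  have h1 : f.ker.relIndex K * K.index = K.relIndex f.ker * f.ker.index := by
    rw [← inf_relIndex_left, relIndex_mul_index inf_le_left, ← inf_relIndex_right,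
      relIndex_mul_index inf_le_right]
  have h2 : f.ker.relIndex K * (K.map f).index = f.ker.index := by
    rw [index_map, f.range_eq_top.2 hf, index_top, mul_one, ← relIndex_sup_right,
      relIndex_mul_index le_sup_right]
  rw [← h2, mul_left_comm] at h1
  refine Nat.eq_of_mul_eq_mul_left (Nat.pos_of_ne_zero ?_) h1
  exact index_ne_zero_of_finite

/-- Let `H` act on `G ⧸ K`: the trivial coset has stabilizer `H ⊓ K`, and its orbit is everything
iff HK = G. -/
theorem coe_mul_coe_eq_univ_iff_index_inf [Finite G] (H K : Subgroup G) :
    (H : Set G) * (K : Set G) = Set.univ ↔ (H ⊓ K).index = H.index * K.index := by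
  have hsmul (x : H) : x • ((1 : G) : G ⧸ K) = ((x : G) : G ⧸ K) :=
    congrArg (QuotientGroup.mk (s := K)) (mul_one (x : G))
  have hstab : MulAction.stabilizer H ((1 : G) : G ⧸ K) = K.subgroupOf H := by
    ext x
    rw [MulAction.mem_stabilizer_iff, mem_subgroupOf, hsmul, eq_comm, QuotientGroup.eq]
    simp
  have hidx : (H ⊓ K).index = K.relIndex H * H.index := by
    rw [← inf_relIndex_left, relIndex_mul_index inf_le_left]
  rw [hidx, mul_comm H.index, mul_left_inj' index_ne_zero_of_finite, relIndex, ← hstab,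
    MulAction.index_stabilizer, index, ← Set.eq_univ_iff_ncard, Set.eq_univ_iff_forall,
    Set.eq_univ_iff_forall]
  constructor
  · intro h q
    obtain ⟨g, rfl⟩ := QuotientGroup.mk_surjective q
    obtain ⟨x, hx, y, hy, rfl⟩ := Set.mem_mul.1 (h g)
    refine ⟨⟨x, hx⟩, ?_⟩
    simp only [hsmul, QuotientGroup.eq]
    simpa using hy
  · intro h g
    obtain ⟨x, hx⟩ := h (g : G ⧸ K)
    simp only [hsmul, QuotientGroup.eq] at hx
    exact Set.mem_mul.2 ⟨x, x.2, _, hx, by simp⟩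

theorem coe_mul_coe_eq_univ_of_coprime_index [Finite G] {H K : Subgroup G}
    (h : H.index.Coprime K.index) : (H : Set G) * (K : Set G) = Set.univ := by
  rw [coe_mul_coe_eq_univ_iff_index_inf]
  exact le_antisymm index_inf_le <| Nat.le_of_dvd (Nat.pos_of_ne_zero index_ne_zero_of_finite) <|
    h.mul_dvd_of_dvd_of_dvd (index_dvd_of_le inf_le_left) (index_dvd_of_le inf_le_right)

theorem natCard_subgroupConjClass (H : Subgroup G) :
    Nat.card (subgroupConjClass H) = (normalizer (H : Set G)).index := by
  let _ : MulAction G (Subgroup G) := MulAction.compHom (Subgroup G) (MulAut.conj : G →* MulAut G)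
  have hsmul (g : G) (K : Subgroup G) : g • K = K.map (MulAut.conj g).toMonoidHom := rfl
  have h1 : subgroupConjClass H = MulAction.orbit G H := by
    ext K
    exact ⟨fun ⟨g, hg⟩ => ⟨g, hg.symm⟩, fun ⟨g, hg⟩ => ⟨g, hg.symm⟩⟩
  have h2 : MulAction.stabilizer G H = normalizer (H : Set G) := by
    ext g
    rw [mem_normalizer_iff_map_conj_eq]
    rfl
  rw [h1, ← h2, MulAction.index_stabilizer]
  rfl

end Subgroup

/-! ### Arithmetic of r^s - 1 and its cofactor modulo divisors of m -/

namespace ZM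

/-- The sum `1 + r ^ s + r ^ (2 s) + ⋯ + r ^ (n - s)`. -/
def geomSum (n r s : ℕ) : ℤ := ∑ k ∈ Finset.range (n / s), ((r : ℤ) ^ s) ^ k

theorem sub_one_mul_geomSum {n r s : ℕ} (hs : s ∣ n) :
    ((r : ℤ) ^ s - 1) * geomSum n r s = (r : ℤ) ^ n - 1 := by
  rw [geomSum, mul_geom_sum, ← pow_mul, Nat.mul_div_cancel' hs]

theorem sub_one_dvd_geomSum_sub (n r s : ℕ) :
    ((r : ℤ) ^ s - 1) ∣ geomSum n r s - ((n / s : ℕ) : ℤ) := by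
  have h : geomSum n r s - ((n / s : ℕ) : ℤ) =
      ∑ k ∈ Finset.range (n / s), (((r : ℤ) ^ s) ^ k - 1) := by
    simp [geomSum]
  rw [h]
  exact Finset.dvd_sum fun k _ => sub_one_dvd_pow_sub_one _ k

namespace Admissible

variable {m n r : ℕ}

theorem dvd_pow_sub_one (h : Admissible m n r) : (m : ℤ) ∣ (r : ℤ) ^ n - 1 := by
  have := (Nat.modEq_iff_dvd.1 h.pow_modEq.symm)
  push_cast at this
  exact this

theorem zmGcd_eq (h : Admissible m n r) {m₁ s : ℕ} (hm : m₁ ∣ m) (hs : s ∣ n) :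
    zmGcd n r m₁ s = Int.gcd m₁ (geomSum n r s) := by
  by_cases hr : r = 1
  · have h1 : m = 1 := by simpa [hr] using h.coprime_m_r
    have h2 : m₁ = 1 := by simpa [h1] using hm
    simp [zmGcd, h2]
  · have hs0 : s ≠ 0 := fun h0 => h.n_pos.ne' (Nat.eq_zero_of_zero_dvd (h0 ▸ hs))
    have hne : (r : ℤ) ^ s - 1 ≠ 0 := by
      rw [sub_ne_zero]
      exact_mod_cast fun h1 => hr ((Nat.pow_eq_one.1 h1).resolve_right hs0)
    rw [zmGcd, ← sub_one_mul_geomSum hs, Int.mul_ediv_cancel_left _ hne]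

/-- Modulo r^s - 1 the sum is n/s, so a common divisor divides both m and n. -/
theorem coprime_gcd_geomSum (h : Admissible m n r) {m₁ s : ℕ} (hm : m₁ ∣ m) (hs : s ∣ n) :
    Nat.Coprime (Int.gcd m₁ ((r : ℤ) ^ s - 1)) (geomSum n r s).natAbs := by
  rw [Nat.coprime_iff_gcd_eq_one, ← Nat.dvd_one, ← h.coprime_m_n]
  set d := Nat.gcd (Int.gcd m₁ ((r : ℤ) ^ s - 1)) (geomSum n r s).natAbs
  have hd : d ∣ Int.gcd m₁ ((r : ℤ) ^ s - 1) := Nat.gcd_dvd_left _ _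
  refine Nat.dvd_gcd ?_ ?_
  · exact (hd.trans (Int.natCast_dvd_natCast.1 (Int.gcd_dvd_left _ _))).trans hm
  · refine dvd_trans ?_ (Nat.div_dvd_of_dvd hs)
    have h1 : (d : ℤ) ∣ (r : ℤ) ^ s - 1 :=
      (Int.natCast_dvd_natCast.2 hd).trans (Int.gcd_dvd_right _ _)
    have h2 : (d : ℤ) ∣ geomSum n r s := Int.natCast_dvd.2 (Nat.gcd_dvd_right _ _)
    exact_mod_cast (dvd_sub_right h2).1 (h1.trans (sub_one_dvd_geomSum_sub n r s))

theorem gcd_mul_gcd_geomSum (h : Admissible m n r) {m₁ s : ℕ} (hm : m₁ ∣ m) (hs : s ∣ n) :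
    Int.gcd m₁ ((r : ℤ) ^ s - 1) * Int.gcd m₁ (geomSum n r s) = m₁ := by
  apply Nat.dvd_antisymm
  · apply Nat.Coprime.mul_dvd_of_dvd_of_dvd
    · exact (h.coprime_gcd_geomSum hm hs).coprime_dvd_right (Nat.gcd_dvd_right _ _)
    · exact Nat.gcd_dvd_left _ _
    · exact Nat.gcd_dvd_left _ _
  · refine dvd_trans ?_ (Nat.gcd_mul_right_dvd_mul_gcd _ _ _)
    refine Nat.dvd_gcd dvd_rfl ?_
    rw [← Int.natAbs_mul, sub_one_mul_geomSum hs, ← Int.natCast_dvd]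
    exact (Int.natCast_dvd_natCast.2 hm).trans h.dvd_pow_sub_one

/-- Of the two complementary factors of m₁, one divides r^s - 1 and the other is coprime to it. -/
theorem dvd_mul_sub_one_iff (h : Admissible m n r) {m₁ s : ℕ} (hm : m₁ ∣ m) (hs : s ∣ n) (t : ℤ) :
    (m₁ : ℤ) ∣ t * ((r : ℤ) ^ s - 1) ↔ (zmGcd n r m₁ s : ℤ) ∣ t := by
  have hprod := h.gcd_mul_gcd_geomSum hm hs
  rw [h.zmGcd_eq hm hs]
  constructor
  · intro hd
    refine IsCoprime.dvd_of_dvd_mul_right ?_ ((Int.gcd_dvd_left _ _).trans hd)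
    rw [Int.isCoprime_iff_gcd_eq_one]
    have hc : Nat.gcd (Nat.gcd m₁ ((r : ℤ) ^ s - 1).natAbs) (geomSum n r s).natAbs = 1 :=
      h.coprime_gcd_geomSum hm hs
    rw [Nat.gcd_right_comm] at hc
    exact hc
  · rintro ⟨c, rfl⟩
    obtain ⟨e, he⟩ := Int.gcd_dvd_right (m₁ : ℤ) ((r : ℤ) ^ s - 1)
    have h3 : (m₁ : ℤ) =
        (Int.gcd m₁ ((r : ℤ) ^ s - 1) : ℤ) * (Int.gcd m₁ (geomSum n r s) : ℤ) := by
      exact_mod_cast hprod.symm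
    refine ⟨c * e, ?_⟩
    calc (Int.gcd m₁ (geomSum n r s) : ℤ) * c * ((r : ℤ) ^ s - 1)
        = (Int.gcd m₁ (geomSum n r s) : ℤ) * c * (Int.gcd m₁ ((r : ℤ) ^ s - 1) * e) :=
          congrArg _ he
      _ = (Int.gcd m₁ ((r : ℤ) ^ s - 1) : ℤ) * (Int.gcd m₁ (geomSum n r s) : ℤ) * (c * e) := by
          ring
      _ = m₁ * (c * e) := by rw [← h3]

/-- If `m₁ ∣ i (1 + r ^ s + ⋯ + r ^ (n - s))`, then `i ≡ t (r ^ s - 1) (mod m₁)` is solvable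
in `t`. -/
theorem exists_dvd_sub_mul (h : Admissible m n r) {m₁ s : ℕ} (hm : m₁ ∣ m) (hs : s ∣ n) {i : ℤ}
    (hi : (m₁ : ℤ) ∣ i * geomSum n r s) : ∃ t : ℤ, (m₁ : ℤ) ∣ i - t * ((r : ℤ) ^ s - 1) := by
  have hc : IsCoprime (Int.gcd m₁ ((r : ℤ) ^ s - 1) : ℤ) (geomSum n r s) := by
    rw [Int.isCoprime_iff_gcd_eq_one]
    exact h.coprime_gcd_geomSum hm hs
  obtain ⟨c, hc'⟩ := hc.dvd_of_dvd_mul_right ((Int.gcd_dvd_left _ _).trans hi)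
  rw [Int.gcd_eq_gcd_ab] at hc'
  exact ⟨Int.gcdB m₁ ((r : ℤ) ^ s - 1) * c, Int.gcdA m₁ ((r : ℤ) ^ s - 1) * c,
    by linear_combination hc'⟩

end Admissible

end ZM

/-! ### Subgroups of the metacyclic group: normal form, invariants, conjugacy, products -/

open Subgroup

namespace ZM

/-- The group `G` is generated by `a` of order `m` and `b` with `b ^ n = 1` and `a b = b a ^ r`, and
`π` is the projection onto `ℤ/n` that kills `a` and sends `b` to `1`. -/
structure IsRealization {G : Type*} [Group G] (m n r : ℕ) (a b : G)
    (π : G →* Multiplicative (ZMod n)) : Prop where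
  adm : Admissible m n r
  mul_comm_b : a * b = b * a ^ r
  b_pow : b ^ n = 1
  orderOf_a : orderOf a = m
  map_a : π a = 1
  map_b : π b = Multiplicative.ofAdd 1
  closure_eq : closure {a, b} = ⊤

namespace IsRealization

variable {G : Type*} [Group G] {m n r : ℕ} {a b : G} {π : G →* Multiplicative (ZMod n)}

theorem zpow_mul_pow (h : IsRealization m n r a b π) (t : ℤ) (k : ℕ) :
    a ^ t * b ^ k = b ^ k * a ^ (t * (r : ℤ) ^ k) := by
  induction k with
  | zero => simp
  | succ k ih =>
    have h1 : SemiconjBy b (a ^ r) a := h.mul_comm_b.symm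
    have h2 := (h1.zpow_right (t * (r : ℤ) ^ k)).eq
    rw [pow_succ, ← mul_assoc, ih, mul_assoc, ← h2, ← mul_assoc, ← zpow_natCast a r, ← zpow_mul]
    congr 2
    ring

theorem pow_mul_zpow_mul (h : IsRealization m n r a b π) (k l : ℕ) (t u : ℤ) :
    b ^ k * a ^ t * (b ^ l * a ^ u) = b ^ (k + l) * a ^ (t * (r : ℤ) ^ l + u) := by
  rw [mul_assoc, ← mul_assoc (a ^ t), h.zpow_mul_pow, pow_add, zpow_add]
  simp only [mul_assoc]

/-- Keeps exponents of b natural, so that r is only raised to natural powers. -/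
theorem pow_inv (h : IsRealization m n r a b π) (k : ℕ) : (b ^ k)⁻¹ = b ^ (k * (n - 1)) := by
  rw [inv_eq_iff_mul_eq_one, ← pow_add]
  obtain ⟨l, rfl⟩ := Nat.exists_eq_succ_of_ne_zero h.adm.n_pos.ne'
  rw [show k + k * (l.succ - 1) = l.succ * k by simp; ring, pow_mul, h.b_pow, one_pow]

theorem pow_mul_zpow_inv (h : IsRealization m n r a b π) (k : ℕ) (t : ℤ) :
    (b ^ k * a ^ t)⁻¹ = b ^ (k * (n - 1)) * a ^ (-t * (r : ℤ) ^ (k * (n - 1))) := by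
  rw [mul_inv_rev, h.pow_inv, ← zpow_neg, h.zpow_mul_pow]

theorem pow_mul_zpow_pow (h : IsRealization m n r a b π) (s : ℕ) (i : ℤ) (k : ℕ) :
    (b ^ s * a ^ i) ^ k =
      b ^ (s * k) * a ^ (i * ∑ j ∈ Finset.range k, ((r : ℤ) ^ s) ^ j) := by
  induction k with
  | zero => simp
  | succ k ih =>
    rw [pow_succ, ih, h.pow_mul_zpow_mul, geom_sum_succ]
    congr 2
    ring

theorem mem_closure_iff (h : IsRealization m n r a b π) (m₁ s : ℕ) (g : G) :
    g ∈ closure {a ^ m₁, b ^ s} ↔ ∃ (k : ℕ) (t : ℤ), g = b ^ (s * k) * a ^ (m₁ * t) := by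
  constructor
  · intro hg
    induction hg using closure_induction with
    | mem x hx =>
      rcases hx with rfl | rfl
      · exact ⟨0, 1, by simp⟩
      · exact ⟨1, 0, by simp⟩
    | one => exact ⟨0, 0, by simp⟩
    | mul x y _ _ hx hy =>
      obtain ⟨k, t, rfl⟩ := hx
      obtain ⟨l, u, rfl⟩ := hy
      refine ⟨k + l, t * (r : ℤ) ^ (s * l) + u, ?_⟩
      rw [h.pow_mul_zpow_mul]
      congr 2 <;> ring
    | inv x _ hx =>
      obtain ⟨k, t, rfl⟩ := hx
      refine ⟨k * (n - 1), -t * (r : ℤ) ^ (s * k * (n - 1)), ?_⟩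
      rw [h.pow_mul_zpow_inv]
      congr 2 <;> ring
  · rintro ⟨k, t, rfl⟩
    refine mul_mem ?_ ?_
    · rw [pow_mul]
      exact pow_mem (subset_closure (by simp)) _
    · rw [zpow_mul, zpow_natCast]
      exact zpow_mem (subset_closure (by simp)) _

theorem exists_eq (h : IsRealization m n r a b π) (g : G) :
    ∃ (k : ℕ) (t : ℤ), g = b ^ k * a ^ t := by
  have := (h.mem_closure_iff 1 1 g).1 (by simp [h.closure_eq])
  simpa using this

theorem map_pow_mul_zpow (h : IsRealization m n r a b π) (k : ℕ) (t : ℤ) :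
    π (b ^ k * a ^ t) = Multiplicative.ofAdd (k : ZMod n) := by
  rw [map_mul, map_pow, map_zpow, h.map_a, h.map_b, one_zpow, mul_one, ← ofAdd_nsmul, nsmul_one]

theorem map_zpow_b (h : IsRealization m n r a b π) (t : ℤ) :
    π b ^ t = Multiplicative.ofAdd (t : ZMod n) := by
  rw [h.map_b, ← ofAdd_zsmul, zsmul_one]

theorem pow_eq_one_of_dvd (h : IsRealization m n r a b π) {k : ℕ} (hk : n ∣ k) : b ^ k = 1 :=
  orderOf_dvd_iff_pow_eq_one.1 ((orderOf_dvd_of_pow_eq_one h.b_pow).trans hk)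

theorem ker_eq (h : IsRealization m n r a b π) : π.ker = zpowers a := by
  apply le_antisymm
  · intro g hg
    obtain ⟨k, t, rfl⟩ := h.exists_eq g
    rw [MonoidHom.mem_ker, h.map_pow_mul_zpow, ofAdd_eq_one, ZMod.natCast_eq_zero_iff] at hg
    rw [h.pow_eq_one_of_dvd hg, one_mul]
    exact zpow_mem_zpowers a t
  · rw [zpowers_le, MonoidHom.mem_ker, h.map_a]

theorem zpowers_map_b (h : IsRealization m n r a b π) : zpowers (π b) = ⊤ := by
  rw [eq_top_iff]
  intro x _
  obtain ⟨t, ht⟩ := ZMod.intCast_surjective x.toAdd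
  exact mem_zpowers_iff.2 ⟨t, by rw [h.map_zpow_b, ht, ofAdd_toAdd]⟩

theorem surjective (h : IsRealization m n r a b π) : Function.Surjective π := by
  rw [← MonoidHom.range_eq_top, eq_top_iff, ← h.zpowers_map_b, zpowers_le]
  exact ⟨b, rfl⟩

theorem finite (h : IsRealization m n r a b π) : Finite G := by
  have : NeZero n := ⟨h.adm.n_pos.ne'⟩
  have : Finite (Multiplicative (ZMod n)) := inferInstanceAs (Finite (ZMod n))
  rw [MonoidHom.finite_iff_finite_ker_range π, h.ker_eq]
  refine ⟨?_, inferInstance⟩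
  exact finite_zpowers.2 (orderOf_pos_iff.1 (h.orderOf_a ▸ h.adm.m_pos))

theorem zpow_mem_iff (_ : IsRealization m n r a b π) (K : Subgroup G) (t : ℤ) :
    a ^ t ∈ K ↔ (K.relIndex (zpowers a) : ℤ) ∣ t :=
  zpow_mem_iff_relIndex_zpowers_dvd K a t

theorem map_b_zpow_mem_iff (h : IsRealization m n r a b π) (K : Subgroup G) (t : ℤ) :
    π b ^ t ∈ K.map π ↔ ((K.map π).index : ℤ) ∣ t := by
  rw [zpow_mem_iff_relIndex_zpowers_dvd, h.zpowers_map_b, relIndex_top_right]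

theorem index_eq (h : IsRealization m n r a b π) (K : Subgroup G) :
    K.index = K.relIndex (zpowers a) * (K.map π).index := by
  have := h.finite
  rw [index_eq_relIndex_ker_mul_index_map h.surjective, h.ker_eq]

theorem relIndex_dvd (h : IsRealization m n r a b π) (K : Subgroup G) :
    K.relIndex (zpowers a) ∣ m := by
  have := K.relIndex_dvd_card (zpowers a)
  rwa [Nat.card_zpowers, h.orderOf_a] at this

theorem index_map_dvd (K : Subgroup G) : (K.map π).index ∣ n := by
  have := (K.map π).index_dvd_card
  rwa [Nat.card_congr Multiplicative.toAdd, Nat.card_zmod] at this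

theorem relIndex_closure (h : IsRealization m n r a b π) {m₁ s : ℕ} (hm : m₁ ∣ m) :
    (closure {a ^ m₁, b ^ s}).relIndex (zpowers a) = m₁ := by
  refine relIndex_zpowers_eq_of_forall_zpow_mem_iff fun t => ?_
  rw [h.mem_closure_iff]
  constructor
  · rintro ⟨k, u, hu⟩
    have h1 : π (b ^ (s * k) * a ^ (m₁ * u)) = 1 := by
      rw [← hu, map_zpow, h.map_a, one_zpow]
    rw [h.map_pow_mul_zpow, ofAdd_eq_one, ZMod.natCast_eq_zero_iff] at h1
    rw [h.pow_eq_one_of_dvd h1, one_mul, zpow_eq_zpow_iff_modEq, h.orderOf_a] at hu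
    have h2 : (m₁ : ℤ) ∣ m₁ * u - t := (Int.natCast_dvd_natCast.2 hm).trans hu.dvd
    exact (dvd_sub_right (dvd_mul_right _ _)).1 h2
  · rintro ⟨u, rfl⟩
    exact ⟨0, u, by simp⟩

theorem index_map_closure (h : IsRealization m n r a b π) {m₁ s : ℕ} (hs : s ∣ n) :
    ((closure {a ^ m₁, b ^ s}).map π).index = s := by
  rw [← relIndex_top_right, ← h.zpowers_map_b]
  refine relIndex_zpowers_eq_of_forall_zpow_mem_iff fun t => ?_
  constructor
  · rintro ⟨g, hg, hgt⟩
    obtain ⟨k, u, rfl⟩ := (h.mem_closure_iff _ _ _).1 hg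
    rw [h.map_pow_mul_zpow, h.map_zpow_b, EmbeddingLike.apply_eq_iff_eq, ← Int.cast_natCast,
      ZMod.intCast_eq_intCast_iff_dvd_sub] at hgt
    have h2 := (Int.natCast_dvd_natCast.2 hs).trans hgt
    push_cast at h2
    exact (dvd_sub_left (dvd_mul_right _ _)).1 h2
  · rintro ⟨u, rfl⟩
    refine ⟨(b ^ s) ^ u, zpow_mem (subset_closure (by simp)) u, ?_⟩
    simp [zpow_mul]

theorem conj_pow (h : IsRealization m n r a b π) (s : ℕ) (t : ℤ) :
    a ^ t * b ^ s * (a ^ t)⁻¹ = b ^ s * a ^ (t * ((r : ℤ) ^ s - 1)) := by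
  rw [h.zpow_mul_pow, ← zpow_neg, mul_assoc, ← zpow_add]
  congr 2
  ring

theorem index_normalizer (h : IsRealization m n r a b π) {m₁ s : ℕ} (hm : m₁ ∣ m) (hs : s ∣ n) :
    (normalizer (closure {a ^ m₁, b ^ s} : Set G)).index = zmGcd n r m₁ s := by
  have := h.finite
  have hbmem : b ^ s ∈ closure {a ^ m₁, b ^ s} := subset_closure (by simp)
  have hamem : a ^ m₁ ∈ closure {a ^ m₁, b ^ s} := subset_closure (by simp)
  have hb : b ∈ normalizer (closure {a ^ m₁, b ^ s} : Set G) := by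
    have : zpowers b ≤ normalizer (closure {a ^ m₁, b ^ s} : Set G) := by
      rw [le_normalizer_closure_iff]
      rintro g hg x (rfl | rfl)
      -- Write g = b^(-j) with j ≥ 0, so that conjugation by g raises `a` to the power r^j.
      · obtain ⟨j, hj⟩ := mem_powers_iff_mem_zpowers.2 (inv_mem hg)
        obtain rfl : g = (b ^ j)⁻¹ := by simp [hj]
        rw [inv_inv, mul_assoc, ← zpow_natCast a, h.zpow_mul_pow, inv_mul_cancel_left, zpow_mul,
          zpow_natCast]
        exact zpow_mem hamem _
      · obtain ⟨k, rfl⟩ := mem_zpowers_iff.1 hg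
        rwa [((Commute.refl b).zpow_left k).pow_right s |>.eq, mul_inv_cancel_right]
    exact this (mem_zpowers b)
  have h1 : ((normalizer (closure {a ^ m₁, b ^ s} : Set G)).map π).index = 1 := by
    rw [index_eq_one, eq_top_iff, ← h.zpowers_map_b, zpowers_le]
    exact mem_map_of_mem π hb
  rw [h.index_eq, h1, mul_one]
  refine relIndex_zpowers_eq_of_forall_zpow_mem_iff fun t => ?_
  rw [← h.adm.dvd_mul_sub_one_iff hm hs]
  constructor
  · intro ht
    have h2 := (mem_normalizer_iff.1 ht (b ^ s)).1 hbmem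
    rw [h.conj_pow, mul_mem_cancel_left hbmem, h.zpow_mem_iff, h.relIndex_closure hm] at h2
    exact h2
  · intro ht
    have : zpowers (a ^ t) ≤ normalizer (closure {a ^ m₁, b ^ s} : Set G) := by
      rw [le_normalizer_closure_iff]
      rintro g hg x (rfl | rfl)
      · obtain ⟨k, rfl⟩ := mem_zpowers_iff.1 hg
        rw [← zpow_mul, ((Commute.refl a).zpow_left _).pow_right m₁ |>.eq, mul_inv_cancel_right]
        exact hamem
      · obtain ⟨k, rfl⟩ := mem_zpowers_iff.1 hg
        rw [← zpow_mul, h.conj_pow]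
        refine mul_mem hbmem ?_
        rw [h.zpow_mem_iff, h.relIndex_closure hm, mul_right_comm]
        exact ht.mul_right k
    exact this (mem_zpowers _)

/-- K contains some b^s a^i, whose (n/s)-th power a^(iQ) forces m₁ ∣ iQ. Hence i ≡ t(r^s - 1) mod m₁
for some t, K contains the conjugate of ⟨a^m₁, b^s⟩ by a^t, and the indices agree. -/
theorem mem_subgroupConjClass_iff (h : IsRealization m n r a b π) {m₁ s : ℕ} (hm : m₁ ∣ m)
    (hs : s ∣ n) (K : Subgroup G) :
    K ∈ subgroupConjClass (closure {a ^ m₁, b ^ s}) ↔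
      K.relIndex (zpowers a) = m₁ ∧ (K.map π).index = s := by
  have := h.finite
  have hidx (g : G) : ((closure {a ^ m₁, b ^ s}).map (MulAut.conj g).toMonoidHom).index = m₁ * s :=
    (index_map_equiv _ (MulAut.conj g)).trans <| by
      rw [h.index_eq, h.relIndex_closure hm, h.index_map_closure hs]
  have hs0 : s ≠ 0 := fun h0 => h.adm.n_pos.ne' (Nat.eq_zero_of_zero_dvd (h0 ▸ hs))
  constructor
  · rintro ⟨g, rfl⟩
    have h1 : ((closure {a ^ m₁, b ^ s}).map (MulAut.conj g).toMonoidHom).map π =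
        (closure {a ^ m₁, b ^ s}).map π := by
      rw [map_map]
      congr 1
      ext x
      simp
    have h2 := hidx g
    rw [h.index_eq, h1, h.index_map_closure hs] at h2
    exact ⟨Nat.eq_of_mul_eq_mul_right (Nat.pos_of_ne_zero hs0) h2, h1 ▸ h.index_map_closure hs⟩
  · rintro ⟨hKm, hKs⟩
    obtain ⟨x, hxK, hx⟩ : π b ^ (s : ℤ) ∈ K.map π := by rw [h.map_b_zpow_mem_iff, hKs]
    obtain ⟨i, hi⟩ : (b ^ s)⁻¹ * x ∈ zpowers a := by
      rw [← h.ker_eq, MonoidHom.mem_ker, map_mul, hx]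
      simp
    obtain rfl : x = b ^ s * a ^ i := (inv_mul_eq_iff_eq_mul.1 hi.symm)
    have hQ : (m₁ : ℤ) ∣ i * geomSum n r s := by
      rw [← hKm, ← h.zpow_mem_iff]
      have h1 := pow_mem hxK (n / s)
      rwa [h.pow_mul_zpow_pow, Nat.mul_div_cancel' hs, h.b_pow, one_mul] at h1
    obtain ⟨t, ht⟩ := h.adm.exists_dvd_sub_mul hm hs hQ
    refine ⟨a ^ t, ?_⟩
    have hle : (closure {a ^ m₁, b ^ s}).map (MulAut.conj (a ^ t)).toMonoidHom ≤ K := by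
      rw [map_le_iff_le_comap, closure_le]
      rintro y (rfl | rfl)
      · change a ^ t * a ^ m₁ * (a ^ t)⁻¹ ∈ K
        rw [((Commute.refl a).zpow_left _).pow_right m₁ |>.eq, mul_inv_cancel_right,
          ← zpow_natCast, h.zpow_mem_iff, hKm]
      · change a ^ t * b ^ s * (a ^ t)⁻¹ ∈ K
        rw [h.conj_pow, ← sub_sub_cancel i (t * ((r : ℤ) ^ s - 1)), zpow_sub, ← mul_assoc]
        exact mul_mem hxK (inv_mem ((h.zpow_mem_iff K _).2 (hKm ▸ ht)))
    refine le_antisymm ?_ hle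
    rw [← relIndex_eq_one]
    have h3 := relIndex_mul_index hle
    rw [hidx, h.index_eq K, hKm, hKs] at h3
    exact Nat.eq_of_mul_eq_mul_right (hKm ▸ hKs ▸ h.index_eq K ▸
      Nat.pos_of_ne_zero index_ne_zero_of_finite) (h3.trans (one_mul _).symm)

theorem coe_mul_coe_eq_univ_iff (h : IsRealization m n r a b π) (K L : Subgroup G) :
    (K : Set G) * (L : Set G) = Set.univ ↔
      (K.relIndex (zpowers a)).gcd (L.relIndex (zpowers a)) = 1 ∧
        (K.map π).index.gcd (L.map π).index = 1 := by
  have := h.finite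
  have hmn : Nat.Coprime m n := h.adm.coprime_m_n
  constructor
  · intro hKL
    constructor
    -- The first invariant of `K ⊓ L` is the lcm and its second divides n. Hence the product of the
    -- first invariants of `K` and `L`, being coprime to n, divides their lcm.
    · have h1 := (coe_mul_coe_eq_univ_iff_index_inf K L).1 hKL
      have h2 : (K ⊓ L).relIndex (zpowers a) =
          (K.relIndex (zpowers a)).lcm (L.relIndex (zpowers a)) := by
        refine relIndex_zpowers_eq_of_forall_zpow_mem_iff fun t => ?_
        rw [mem_inf, h.zpow_mem_iff, h.zpow_mem_iff, Int.natCast_dvd, Int.natCast_dvd,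
          Int.natCast_dvd, Nat.lcm_dvd_iff]
      rw [h.index_eq, h.index_eq K, h.index_eq L, h2, mul_mul_mul_comm] at h1
      have h3 := (Nat.Coprime.mul_left (hmn.coprime_dvd_left (h.relIndex_dvd K))
        (hmn.coprime_dvd_left (h.relIndex_dvd L))).coprime_dvd_right
        (index_map_dvd (π := π) (K ⊓ L))
      have h4 := h3.dvd_of_dvd_mul_right (Dvd.intro _ h1.symm)
      rw [← Nat.gcd_mul_lcm] at h4
      refine Nat.dvd_one.1 (Nat.dvd_of_mul_dvd_mul_right (Nat.pos_of_ne_zero ?_)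
        (h4.trans (one_mul _).symm.dvd))
      exact h2 ▸ index_ne_zero_of_finite
    -- Factoring b = xy gives u + v ≡ 1 mod n, where the gcd divides u, v and n.
    · obtain ⟨x, hx, y, hy, hxy⟩ := Set.mem_mul.1 (hKL.symm ▸ Set.mem_univ b)
      obtain ⟨u, hu⟩ := mem_zpowers_iff.1 (h.zpowers_map_b ▸ mem_top (π x))
      obtain ⟨v, hv⟩ := mem_zpowers_iff.1 (h.zpowers_map_b ▸ mem_top (π y))
      have hu' := (h.map_b_zpow_mem_iff K u).1 (hu ▸ mem_map_of_mem π hx)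
      have hv' := (h.map_b_zpow_mem_iff L v).1 (hv ▸ mem_map_of_mem π hy)
      have h1 : π b ^ (u + v) = π b ^ (1 : ℤ) := by
        rw [zpow_add, hu, hv, ← map_mul, hxy, zpow_one]
      rw [h.map_zpow_b, h.map_zpow_b, EmbeddingLike.apply_eq_iff_eq,
        ZMod.intCast_eq_intCast_iff_dvd_sub] at h1
      rw [← Nat.dvd_one]
      set d := (K.map π).index.gcd (L.map π).index
      have hd1 : (d : ℤ) ∣ u := (Int.natCast_dvd_natCast.2 (Nat.gcd_dvd_left _ _)).trans hu'
      have hd2 : (d : ℤ) ∣ v := (Int.natCast_dvd_natCast.2 (Nat.gcd_dvd_right _ _)).trans hv'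
      have hd3 : (d : ℤ) ∣ n :=
        Int.natCast_dvd_natCast.2 ((Nat.gcd_dvd_left _ _).trans (index_map_dvd K))
      have := (dvd_sub_left (dvd_add hd1 hd2)).1 (hd3.trans h1)
      exact_mod_cast this
  · rintro ⟨h1, h2⟩
    apply coe_mul_coe_eq_univ_of_coprime_index
    rw [h.index_eq K, h.index_eq L]
    have hc (K L : Subgroup G) : (K.relIndex (zpowers a)).Coprime (L.map π).index :=
      (hmn.coprime_dvd_left (h.relIndex_dvd K)).coprime_dvd_right (index_map_dvd L)
    exact Nat.Coprime.mul_left (Nat.Coprime.mul_right h1 (hc K L))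
      (Nat.Coprime.mul_right (hc L K).symm h2)

end IsRealization

end ZM

/-! ### Counting factorizations by invariants, and passage to the presented group -/

namespace ZM

namespace IsRealization

variable {G : Type*} [Group G] {m n r : ℕ} {a b : G} {π : G →* Multiplicative (ZMod n)}

theorem natCard_subgroupConjClass (h : IsRealization m n r a b π) {m₁ s : ℕ} (hm : m₁ ∣ m)
    (hs : s ∣ n) : Nat.card (subgroupConjClass (closure {a ^ m₁, b ^ s})) = zmGcd n r m₁ s := by
  rw [Subgroup.natCard_subgroupConjClass, h.index_normalizer hm hs]

theorem factorizationNumber_eq (h : IsRealization m n r a b π) :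
    factorizationNumber G =
      ∑ p ∈ m.divisors ×ˢ m.divisors with Nat.gcd p.1 p.2 = 1,
        ∑ q ∈ n.divisors ×ˢ n.divisors with Nat.gcd q.1 q.2 = 1,
          zmGcd n r p.1 q.1 * zmGcd n r p.2 q.2 := by
  classical
  have := h.finite
  have := Fintype.ofFinite (Subgroup G)
  let inv : Subgroup G × Subgroup G → (ℕ × ℕ) × (ℕ × ℕ) := fun K =>
    ((K.1.relIndex (zpowers a), K.2.relIndex (zpowers a)),
      ((K.1.map π).index, (K.2.map π).index))
  have hmem (K : Subgroup G × Subgroup G) :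
      (K.1 : Set G) * (K.2 : Set G) = Set.univ ↔
        inv K ∈ ((m.divisors ×ˢ m.divisors).filter fun p => Nat.gcd p.1 p.2 = 1) ×ˢ
          ((n.divisors ×ˢ n.divisors).filter fun q => Nat.gcd q.1 q.2 = 1) := by
    simp [inv, h.coe_mul_coe_eq_univ_iff, h.relIndex_dvd, index_map_dvd, h.adm.m_pos.ne',
      h.adm.n_pos.ne']
  rw [factorizationNumber, Nat.card_eq_fintype_card, Fintype.card_subtype,
    Finset.card_eq_sum_card_fiberwise (f := inv) (fun K hK => (hmem K).1 (by simpa using hK)),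
    Finset.sum_product]
  refine Finset.sum_congr rfl fun p hp => Finset.sum_congr rfl fun q hq => ?_
  simp only [Finset.mem_filter, Finset.mem_product, Nat.mem_divisors] at hp hq
  rw [← h.natCard_subgroupConjClass hp.1.1.1 hq.1.1.1,
    ← h.natCard_subgroupConjClass hp.1.2.1 hq.1.2.1, ← Nat.card_prod,
    ← Nat.card_congr (Equiv.Set.prod _ _), ← Set.ncard_coe_finset,
    Nat.card_coe_set_eq]
  congr 1
  ext K
  have hfib : inv K = (p, q) → (K.1 : Set G) * (K.2 : Set G) = Set.univ := fun hK => by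
    rw [hmem, hK]
    simp [hp, hq]
  rw [Finset.mem_coe, Finset.mem_filter, Finset.mem_filter, Set.mem_prod,
    h.mem_subgroupConjClass_iff hp.1.1.1 hq.1.1.1, h.mem_subgroupConjClass_iff hp.1.2.1 hq.1.2.1]
  rw [and_and_and_comm, and_iff_right_of_imp fun hK => ⟨Finset.mem_univ K, hfib hK⟩]
  simp only [inv, Prod.ext_iff]

end IsRealization

theorem forall_mem_zmRels_lift_eq_one {G : Type*} [Group G] {m n r : ℕ} {x y : G}
    (hx : x ^ m = 1) (hy : y ^ n = 1) (hxy : x * y = y * x ^ r) :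
    ∀ w ∈ zmRels m n r, FreeGroup.lift ![x, y] w = 1 := by
  rintro w (rfl | rfl | rfl)
  · simpa using hx
  · simpa using hy
  · simp [mul_assoc y⁻¹, hxy]

theorem exists_isRealization {m n r : ℕ} (h : Admissible m n r) :
    ∃ π : ZM m n r →* Multiplicative (ZMod n), IsRealization m n r (a m n r) (b m n r) π := by
  have hrel {w : FreeGroup (Fin 2)} (hw : w ∈ zmRels m n r) :
      PresentedGroup.mk (zmRels m n r) w = 1 :=
    PresentedGroup.one_of_mem hw
  have ha : a m n r ^ m = 1 := hrel (by simp [zmRels])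
  have hb : b m n r ^ n = 1 := hrel (w := FreeGroup.of 1 ^ n) (by simp [zmRels])
  have hab : (b m n r)⁻¹ * a m n r * b m n r * (a m n r ^ r)⁻¹ = 1 :=
    hrel (w := (FreeGroup.of 1)⁻¹ * FreeGroup.of 0 * FreeGroup.of 1 * (FreeGroup.of 0 ^ r)⁻¹)
      (by simp [zmRels])
  have hπ : ∀ w ∈ zmRels m n r,
      FreeGroup.lift ![1, Multiplicative.ofAdd (1 : ZMod n)] w = 1 :=
    forall_mem_zmRels_lift_eq_one (one_pow m)
      (by rw [← ofAdd_nsmul, nsmul_one, ZMod.natCast_self, ofAdd_zero]) (by simp)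
  have hr : (r : ZMod m) ^ n = 1 := by
    exact_mod_cast (ZMod.natCast_eq_natCast_iff _ _ _).2 h.pow_modEq
  let ρ : (ZMod m)ˣ := Units.ofPowEqOne (r : ZMod m) n hr h.n_pos.ne'
  -- The order of `a` could collapse in the presentation; letting `a` act on ℤ/m by x ↦ x + 1 and
  -- `b` by x ↦ r⁻¹x shows that it is a multiple of m.
  let α : Equiv.Perm (ZMod m) := Equiv.addRight 1
  let β : Equiv.Perm (ZMod m) := MulAction.toPermHom (ZMod m)ˣ (ZMod m) ρ⁻¹
  have hα (k : ℕ) (x : ZMod m) : (α ^ k) x = x + k := by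
    induction k with
    | zero => simp
    | succ k ih =>
      rw [pow_succ', Equiv.Perm.mul_apply, ih]
      simp [α, add_assoc]
  have hφ : ∀ w ∈ zmRels m n r, FreeGroup.lift ![α, β] w = 1 := by
    refine forall_mem_zmRels_lift_eq_one ?_ ?_ ?_
    · ext x
      simp [hα]
    · have : ρ ^ n = 1 := Units.pow_ofPowEqOne hr h.n_pos.ne'
      rw [← map_pow, inv_pow, this, inv_one, map_one]
    · ext x
      have h1 : ρ⁻¹ • (r : ZMod m) = 1 := by
        rw [inv_smul_eq_iff]
        simp [ρ, Units.smul_def]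
      change ρ⁻¹ • x + 1 = ρ⁻¹ • ((α ^ r) x)
      rw [hα, smul_add, h1]
  refine ⟨PresentedGroup.toGroup hπ, h, ?_, hb, ?_, ?_, ?_, ?_⟩
  · rw [mul_inv_eq_one] at hab
    rw [← hab]
    group
  · refine Nat.dvd_antisymm (orderOf_dvd_of_pow_eq_one ha) ?_
    have h1 : PresentedGroup.toGroup hφ (a m n r) = α := PresentedGroup.toGroup.of hφ
    have h2 : α ^ orderOf (a m n r) = 1 := by rw [← h1, ← map_pow, pow_orderOf_eq_one, map_one]
    have h3 := DFunLike.congr_fun h2 0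
    rwa [hα, zero_add, Equiv.Perm.one_apply, ZMod.natCast_eq_zero_iff] at h3
  · exact PresentedGroup.toGroup.of hπ
  · exact PresentedGroup.toGroup.of hπ
  · rw [← PresentedGroup.closure_range_of (zmRels m n r)]
    congr 1
    ext x
    simp [Fin.exists_fin_two, a, b, eq_comm]

end ZM

/-- The size of the conjugacy class of each `H(m₁, n₁, 0)`, the resulting formula for the
factorization number of `ZM(m, n, r)`, and its value for `(m, n, r) = (9, 4, 8)`. -/
theorem theorem3p1 :
    (∀ m n r : ℕ, ZM.Admissible m n r →
      (∀ m₁ n₁ : ℕ, m₁ ∣ m → n₁ ∣ n →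
        Nat.card (subgroupConjClass (ZM.H m n r m₁ n₁)) = zmGcd n r m₁ n₁) ∧
      factorizationNumber (ZM m n r) =
        ∑ p ∈ m.divisors ×ˢ m.divisors with Nat.gcd p.1 p.2 = 1,
          ∑ q ∈ n.divisors ×ˢ n.divisors with Nat.gcd q.1 q.2 = 1,
            zmGcd n r p.1 q.1 * zmGcd n r p.2 q.2) ∧
    factorizationNumber (ZM 9 4 8) = 85 := by
  refine ⟨fun m n r h => ?_, ?_⟩
  · obtain ⟨π, hπ⟩ := ZM.exists_isRealization h
    exact ⟨fun m₁ n₁ hm hn => hπ.natCard_subgroupConjClass hm hn, hπ.factorizationNumber_eq⟩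
  · obtain ⟨π, hπ⟩ := ZM.exists_isRealization
      (⟨by decide, by decide, by decide, by decide, by decide⟩ : ZM.Admissible 9 4 8)
    rw [hπ.factorizationNumber_eq]
    decide +kernel
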